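/- **Setting.** Fix a horizon $T$. An oblivious adversary fixes valuations $(s_1,b_1),\dots,(s_T,b_T)\in[0,1]^2$ of a seller and a buyer. In round $t$ a randomized learner posts a price $p_t\in[0,1]$ to the seller and $q_t\in[0,1]$ to the buyer, $p_t\le q_t$, and then observes only the bit $\mathbf 1\{s_t\le p_t\le q_t\le b_t\}$ (trade or no trade). The gain from trade is $\mathrm{GFT}_t(p,q)=\mathbf 1\{s_t\le p\le q\le b_t\}\,(b_t-s_t)$. The $2$-regret of a learner $\mathcal A$ is $$R_T^2(\mathcal A)=\sup_{(s_t,b_t)_{t}}\Big\{\max_{p,q\in[0,1]}\sum_{t=1}^T\mathrm{GFT}_t(p,q)-2\sum_{t=1}^T\mathbb E\big[\mathrm{GFT}_t(p_t,q_t)\big]\Big\}.$$ **Algorithm.** Block-Decomposition (BD) has as parameters a number of blocks $S$, a finite grid $Q\subset[0,1]$ and an algorithm $\mathcal E$ for prediction with experts, whose actions are the prices in $Q$ and whose time horizon is $S$. The rounds are divided into $S$ consecutive blocks of length $\Delta=\lceil T/S\rceil\ge|Q|$ (if $S\nmid T$, the rounds after $T$ are dummy rounds). In each block $\tau$, BD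 receives a price $p_\tau\in Q$ from $\mathcal E$ and draws a uniformly random injection $h_\tau$ of $Q$ into the rounds of the block. In round $h_\tau(p)$, $p\in Q$, it tosses a coin with head probability $p$; with heads it posts $(U,p)$ with $U$ uniform in $[0,p]$, with tails $(p,V)$ with $V$ uniform in $[p,1]$; the feedback bit is the estimate $\widehat{\mathrm{GFT}}_\tau(p)$. In all other rounds of the block it posts $(p_\tau,p_\tau)$ and ignores the feedback. At the end of the block the estimates $(\widehat{\mathrm{GFT}}_\tau(p))_{p\in Q}$ are fed to $\mathcal E$ as the gains of the actions. Multiplicative Weights with learning rate $\eta$ starts with all weights $1$, multiplies the weight of an action by $1+\eta g$ when its gain is $g$, and draws each action with probability proportional to its weight. **Theorem.** Let $T\ge2$ be an integer. Run BD with $S=\lfloor\sqrt T\rfloor$ blocks, the grid $Q=\{i/n:0\le i\le n\}$ with $n=\lfloor T^{1/4}\rfloor$, and Multiplicative Weights with learning rate $\sqrt{\log|Q|/S}$ (so that, if $T$ is a fourth power, the blocks have length $\sqrt T$ and the grid has step $T^{-1/4}$). Then $$R_T^2(\mathrm{BD})\le 5\,T^{3/4}\sqrt{\log T},$$ where $\log$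 is the natural logarithm. -/

import Mathlib

open MeasureTheory
open scoped unitInterval

namespace BilateralTrade

/-- Gain from trade `𝟙{s ≤ p ≤ q ≤ b} * (b - s)`, where `x = (p, q)` are the prices posted to the
seller and to the buyer, and `v = (s, b)` are the valuations of the seller and of the buyer. -/
noncomputable def gft (x v : I × I) : ℝ :=
  open Classical in if v.1 ≤ x.1 ∧ x.1 ≤ x.2 ∧ x.2 ≤ v.2 then (v.2 : ℝ) - v.1 else 0

/-- One-bit feedback: did the trade take place? -/
noncomputable def tradeBit (x v : I × I) : Bool :=
  open Classical in decide (v.1 ≤ x.1 ∧ x.1 ≤ x.2 ∧ x.2 ≤ v.2)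

/-- A (randomized) learning algorithm with time horizon `T` that posts two prices and receives
one-bit feedback. The internal randomization is a seed drawn once from a probability law; the
prices `(p, q)` posted in round `t` depend on the seed and on the feedback bits of the rounds
before `t` only. Rounds are numbered `0, …, T - 1`. -/
structure Learner (T : ℕ) where
  /-- The space of random seeds. -/
  Seed : Type
  [instSeed : MeasurableSpace Seed]
  /-- The law of the seed. -/
  law : Measure Seed
  [instProb : IsProbabilityMeasure law]
  /-- The prices posted in round `t`, given the feedback so far. -/
  post : (t : Fin T) → (Fin t → Bool) → Seed → I × I
  measurable_post : ∀ t past, Measurable (post t past)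
  /-- Weak budget balance. -/
  budget_balance : ∀ t past ω, (post t past ω).1 ≤ (post t past ω).2

attribute [instance] Learner.instSeed Learner.instProb

namespace Learner

variable {T : ℕ}

/-- The feedback bits that the learner receives in the first `t` rounds, if the valuations are `v`
and the seed is `ω`. -/
noncomputable def feedback (A : Learner T) (v : Fin T → I × I) (ω : A.Seed) :
    (t : ℕ) → t ≤ T → Fin t → Bool
  | 0, _ => Fin.elim0
  | t + 1, h =>
    let past := A.feedback v ω t (Nat.le_of_succ_le h)
    Fin.snoc (α := fun _ => Bool) past (tradeBit (A.post ⟨t, h⟩ past ω) (v ⟨t, h⟩))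

/-- The prices `(p_t, q_t)` that the learner posts in round `t`, as a random variable. -/
noncomputable def prices (A : Learner T) (v : Fin T → I × I) (t : Fin T) (ω : A.Seed) : I × I :=
  A.post t (A.feedback v ω t t.2.le) ω

/-- The `α`-regret against the sequence of valuations `v`. -/
noncomputable def regret (α : ℝ) (A : Learner T) (v : Fin T → I × I) : ℝ :=
  (⨆ x : I × I, ∑ t, gft x (v t)) - α * ∑ t, ∫ ω, gft (A.prices v t ω) (v t) ∂A.law

/-- The `α`-regret: the supremum of the regrets over all sequences of valuations. -/
noncomputable def worstRegret (α : ℝ) (A : Learner T) : ℝ :=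
  ⨆ v : Fin T → I × I, A.regret α v

end Learner

/-- A (randomized) algorithm for prediction with experts, with time horizon `S` and `K` actions.
The action chosen in round `τ` depends on a random seed and on the gains of all actions in the
rounds before `τ`. -/
structure ExpertAlgorithm (S K : ℕ) where
  /-- The space of random seeds. -/
  Seed : Type
  [instSeed : MeasurableSpace Seed]
  /-- The law of the seed. -/
  law : Measure Seed
  [instProb : IsProbabilityMeasure law]
  /-- The action played in round `τ`, given the gains so far. -/
  play : (τ : Fin S) → (Fin τ → Fin K → ℝ) → Seed → Fin K
  measurable_play : ∀ τ gains, Measurable (play τ gains)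

attribute [instance] ExpertAlgorithm.instSeed ExpertAlgorithm.instProb

/-- Sampling by inversion of the distribution function: for `u` uniform in `[0, 1]`, the result is
`k` with probability `w k / ∑ j, w j` (for nonnegative weights `w` with positive sum). It is the
number of the indices `k` with `(w 0 + ⋯ + w k) / ∑ j, w j ≤ u`; this number is less than `K`
when `u < 1`. -/
noncomputable def sample {K : ℕ} [NeZero K] (w : Fin K → ℝ) (u : I) : Fin K :=
  open Classical in
  Fin.ofNat K (∑ k, if ∑ j ∈ Finset.Iic k, w j ≤ u * ∑ j, w j then 1 else 0)

theorem measurable_sample {K : ℕ} [NeZero K] (w : Fin K → ℝ) : Measurable (sample w) := by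
  classical
  unfold sample
  have h : ∀ k : Fin K, Measurable fun u : I =>
      if ∑ j ∈ Finset.Iic k, w j ≤ (u : ℝ) * ∑ j, w j then (1 : ℕ) else 0 := fun k =>
    Measurable.ite (measurableSet_le measurable_const (measurable_subtype_coe.mul_const _))
      measurable_const measurable_const
  exact (measurable_from_nat (f := Fin.ofNat K)).comp
    (Finset.measurable_sum Finset.univ fun k _ => h k)

/-- Multiplicative Weights with learning rate `η`: all weights are `1` at the beginning, the weight
of an action is multiplied by `1 + η g` when its gain is `g`, and in every round an action is
drawn, with fresh randomness, with probability proportional to its weight. -/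
noncomputable def multiplicativeWeights (S K : ℕ) [NeZero K] (η : ℝ) : ExpertAlgorithm S K where
  Seed := Fin S → I
  law := Measure.pi fun _ => volume
  play τ gains u := sample (fun k => ∏ τ' : Fin τ, (1 + η * gains τ' k)) (u τ)
  measurable_play τ _ := by
    refine (measurable_sample _).comp ?_
    exact measurable_pi_apply τ

/-- The prices posted by the estimation procedure for the gain from trade of the price `p`, with
`z = (c, x)` uniform in `[0, 1]²`. The coin shows heads (`c < p`) with probability `p`. With heads,
the prices are `(U, p)` with `U = p x` uniform in `[0, p]`; with tails, they are `(p, V)` with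
`V = p + (1 - p) x` uniform in `[p, 1]`. The estimate is the feedback bit. -/
noncomputable def estimatorPrices (p : I) (z : I × I) : I × I :=
  if z.1 < p then (p * z.2, p)
  else (p, ⟨p + (1 - p) * z.2,
    add_nonneg p.2.1 (mul_nonneg (sub_nonneg.2 p.2.2) z.2.2.1),
    by nlinarith [p.2.2, z.2.2.2]⟩)

theorem measurable_estimatorPrices (p : I) : Measurable (estimatorPrices p) := by
  refine Measurable.ite (measurableSet_lt measurable_fst measurable_const) ?_ ?_
  · refine Measurable.prodMk (Measurable.subtype_mk ?_) measurable_const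
    fun_prop
  · exact measurable_const.prodMk (Measurable.subtype_mk (by fun_prop))

theorem estimatorPrices_le (p : I) (z : I × I) :
    (estimatorPrices p z).1 ≤ (estimatorPrices p z).2 := by
  unfold estimatorPrices
  split_ifs
  · exact unitInterval.mul_le_left
  · exact Subtype.coe_le_coe.1
      (le_add_of_nonneg_right (mul_nonneg (sub_nonneg.2 p.2.2) z.2.2.1))

/-- The length `⌈T / S⌉` of a block if `T` rounds are divided into `S` blocks. If `S` does not
divide `T`, the rounds after `T - 1` in the last blocks are dummy rounds. -/
def blockLength (T S : ℕ) : ℕ := T ⌈/⌉ S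

theorem div_blockLength_lt {T S : ℕ} (hS : 0 < S) (t : Fin T) : t / blockLength T S < S := by
  have h : T ≤ S * blockLength T S := by
    simpa [smul_eq_mul, blockLength] using le_smul_ceilDiv (b := T) hS
  refine Nat.div_lt_of_lt_mul ?_
  rw [mul_comm]
  exact t.2.trans_le h

/-- Every set of injections is measurable. -/
instance instMeasurableSpaceInjection (K D : ℕ) : MeasurableSpace (Fin K ↪ Fin D) := ⊤

instance instDiscreteInjection (K D : ℕ) : DiscreteMeasurableSpace (Fin K ↪ Fin D) :=
  ⟨fun _ => trivial⟩

/-- The uniform law on the injections from `K` grid points to the `D` rounds of a block. -/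
noncomputable def injectionLaw {K D : ℕ} (h : K ≤ D) : Measure (Fin K ↪ Fin D) :=
  haveI : Nonempty (Fin K ↪ Fin D) := ⟨Fin.castLEEmb h⟩
  (PMF.uniformOfFintype (Fin K ↪ Fin D)).toMeasure

instance instProbInjectionLaw {K D : ℕ} (h : K ≤ D) : IsProbabilityMeasure (injectionLaw h) := by
  unfold injectionLaw
  infer_instance

/-- The estimated gains of the blocks before block `τ`, read off from the feedback bits of the
rounds before `t`, where `t` belongs to block `τ`: the estimated gain of grid point `i` in block
`τ'` is the bit received in the round of this block to which the injection `h τ'` sends `i`. -/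
def estimatedGains {S K D t : ℕ} (h : Fin S → Fin K ↪ Fin D) (past : Fin t → Bool)
    (τ : Fin S) (τ' : Fin τ) (i : Fin K) : ℝ :=
  if hr : τ' * D + h (τ'.castLE τ.2.le) i < t then
    if past ⟨τ' * D + h (τ'.castLE τ.2.le) i, hr⟩ then 1 else 0
  else 0

/-- The prices posted in a block in the round with position `r`: if the injection `h` sends a grid
point `i` to this round, then the estimation procedure for the price `Q i`, with the randomness
`z i`, is used; otherwise the price `Q a` is posted to both agents. -/
noncomputable def blockPrices {K D : ℕ} (Q : Fin K → I) (h : Fin K ↪ Fin D) (z : Fin K → I × I)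
    (a : Fin K) (r : ℕ) : I × I :=
  open Classical in
  if hi : ∃ i, (h i : ℕ) = r then estimatorPrices (Q hi.choose) (z hi.choose) else (Q a, Q a)

theorem blockPrices_le {K D : ℕ} (Q : Fin K → I) (h : Fin K ↪ Fin D) (z : Fin K → I × I)
    (a : Fin K) (r : ℕ) : (blockPrices Q h z a r).1 ≤ (blockPrices Q h z a r).2 := by
  unfold blockPrices
  split_ifs
  · exact estimatorPrices_le _ _
  · exact le_rfl

/-- The algorithm Block-Decomposition with time horizon `T`, `S` blocks, grid `Q` and expert
algorithm `E`. The seed consists of the seed of `E`, one uniform injection per block, and one pair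
of uniform numbers per block and grid point, for the estimation procedures; all are independent.
Round `t` is the round with position `t % Δ` in block `t / Δ`. -/
noncomputable def blockDecomposition (T S : ℕ) {K : ℕ} (Q : Fin K → I) (E : ExpertAlgorithm S K)
    (hS : 0 < S) (hK : K ≤ blockLength T S) : Learner T where
  Seed := (Fin S → Fin K ↪ Fin (blockLength T S)) × E.Seed × (Fin S → Fin K → I × I)
  law := (Measure.pi fun _ => injectionLaw hK).prod
    (E.law.prod (Measure.pi fun _ => Measure.pi fun _ => volume))
  post t past ω :=
    let τ : Fin S := ⟨t / blockLength T S, div_blockLength_lt hS t⟩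
    let a := E.play τ (estimatedGains ω.1 past τ) ω.2.1
    blockPrices Q (ω.1 τ) (ω.2.2 τ) a (t % blockLength T S)
  measurable_post t past := by
    refine measurable_from_prod_countable_right fun h => ?_
    unfold blockPrices
    dsimp only
    split_ifs with hi
    · refine (measurable_estimatorPrices _).comp ?_
      fun_prop
    · have hQ : Measurable fun a : Fin K => (Q a, Q a) := measurable_of_finite _
      exact hQ.comp ((E.measurable_play _ _).comp measurable_fst)
  budget_balance _ _ _ := blockPrices_le _ _ _ _ _

/-- The uniform grid of the multiples `i / n` of `1 / n` in `[0, 1]`, for `i = 0, …, n`. -/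
noncomputable def uniformGrid (n : ℕ) (i : Fin (n + 1)) : I :=
  ⟨(i : ℝ) / n, div_nonneg (Nat.cast_nonneg _) (Nat.cast_nonneg _),
    div_le_one_of_le₀ (Nat.cast_le.2 (Nat.lt_succ_iff.1 i.2)) (Nat.cast_nonneg _)⟩

theorem grid_card_le_blockLength {T : ℕ} (hT : 2 ≤ T) :
    T.sqrt.sqrt + 1 ≤ blockLength T T.sqrt := by
  have hS : 0 < T.sqrt := Nat.sqrt_pos.2 (by omega)
  have h1 : T ≤ T.sqrt * blockLength T T.sqrt := by
    simpa [smul_eq_mul, blockLength] using le_smul_ceilDiv (b := T) hS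
  have h2 := Nat.sqrt_le T
  have h3 := Nat.sqrt_le T.sqrt
  have h4 : 0 < T.sqrt.sqrt := Nat.sqrt_pos.2 hS
  by_contra hlt
  generalize blockLength T T.sqrt = D at *
  generalize T.sqrt.sqrt = n at *
  generalize T.sqrt = m at *
  have h5 : D ≤ n := by omega
  have h6 : m ≤ D := by
    refine Nat.le_of_mul_le_mul_left (h2.trans h1) hS
  have h7 : n ≤ 1 := by nlinarith
  have h8 : m = 1 := by omega
  have h9 : D ≤ 1 := by omega
  subst h8
  omega

/-- Block-Decomposition with `⌊√T⌋` blocks, the uniform grid with step `1 / ⌊T ^ (1 / 4)⌋`, and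
Multiplicative Weights with learning rate `√(log K / S)`, where `S` is the number of blocks and `K`
the number of grid points. If `T` is a fourth power, then the blocks have length `√T` and the grid
has step `T ^ (-1 / 4)`. -/
noncomputable def tunedBlockDecomposition (T : ℕ) (hT : 2 ≤ T) : Learner T :=
  blockDecomposition T T.sqrt (uniformGrid T.sqrt.sqrt)
    (multiplicativeWeights T.sqrt (T.sqrt.sqrt + 1)
      (√(Real.log ((T.sqrt.sqrt + 1 : ℕ) : ℝ) / T.sqrt)))
    (Nat.sqrt_pos.2 (by omega)) (grid_card_le_blockLength hT)

end BilateralTrade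

/-! ### Gain from trade and discretization of the prices -/

namespace BilateralTrade

/-! The factor 2 pays for replacing two prices by one grid price. Let `a ≤ p ≤ b` be neighbouring
grid points. If `(p, q)` trades, then the single price `a` trades, or `b` does, or both valuations
lie strictly between `a` and `b` and the gain is below `b - a`. So the best pair earns at most twice
the best grid price plus `T / n` (`gft_le_add`, `sum_gft_le_of_grid`).

It remains to compete with each grid price, with constant 1. One bit estimates the gain of a price
`p` without bias: if `s ≤ p ≤ b`, the heads case contributes `p - s` to the trade probability and
the tails case `b - p`; otherwise no trade occurs. As the exploration round is uniform in its block,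
the expected estimate is the average gain of `p` over the block (`mul_integral_explorationLaw`).

The prices posted for exploration do not depend on the expert's choices, so the bits of different
blocks are independent of each other and of the expert's seed. The expert's regret bound, applied to
each realization of the bits, therefore survives averaging, and the bit of the current block may be
replaced by its mean (`ExpertAlgorithm.RegretAtMost.integral_le`). Scaling by the block length `D`
and paying at most `K` per block for exploration gives a loss `D * R + S * K`
(`sum_gft_sub_le_sum_integral`).

For Multiplicative Weights, `R = 3 / 2 * √(S * log K)`. With the chosen `S` and `n`, the terms `T /
n` and `S * K` are of order `T ^ (3 / 4)`, and `D * R` has the additional factor `√(log T)`. -/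

theorem gft_nonneg (x v : I × I) : 0 ≤ gft x v := by
  unfold gft
  split_ifs with h
  · exact sub_nonneg.2 (h.1.trans (h.2.1.trans h.2.2))
  · exact le_rfl

theorem gft_le_one (x v : I × I) : gft x v ≤ 1 := by
  unfold gft
  split_ifs
  · linarith [v.2.2.2, v.1.2.1]
  · exact zero_le_one

theorem measurableSet_trade (v : I × I) :
    MeasurableSet {x : I × I | v.1 ≤ x.1 ∧ x.1 ≤ x.2 ∧ x.2 ≤ v.2} :=
  (measurableSet_le measurable_const measurable_fst).inter
    ((measurableSet_le measurable_fst measurable_snd).inter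
      (measurableSet_le (f := Prod.snd) (g := fun _ => v.2) measurable_snd measurable_const))

theorem measurable_gft (v : I × I) : Measurable fun x => gft x v := by
  classical
  unfold gft
  exact Measurable.ite (measurableSet_trade v) measurable_const measurable_const

theorem measurable_tradeBit (v : I × I) : Measurable fun x => tradeBit x v := by
  classical
  have : (fun x => tradeBit x v) =
      fun x => if v.1 ≤ x.1 ∧ x.1 ≤ x.2 ∧ x.2 ≤ v.2 then true else false := by
    funext x
    unfold tradeBit
    split_ifs with h <;> simp [h]
  rw [this]
  exact Measurable.ite (measurableSet_trade v) measurable_const measurable_const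

/-- Two prices between neighbouring values `a ≤ b` earn at most what the single prices `a` and `b`
earn together, plus `b - a`. -/
theorem gft_le_add (x v : I × I) {a b : I} (ha : a ≤ x.1) (hb : x.1 ≤ b) :
    gft x v ≤ gft (a, a) v + gft (b, b) v + (b - a : ℝ) := by
  have hab : (0 : ℝ) ≤ b - a := sub_nonneg.2 (ha.trans hb)
  by_cases h : v.1 ≤ x.1 ∧ x.1 ≤ x.2 ∧ x.2 ≤ v.2
  · have e : gft x v = v.2 - v.1 := if_pos h
    by_cases h1 : v.1 ≤ a
    · have e1 : gft (a, a) v = v.2 - v.1 :=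
        if_pos ⟨h1, le_rfl, ha.trans (h.2.1.trans h.2.2)⟩
      linarith [gft_nonneg (b, b) v]
    by_cases h2 : b ≤ v.2
    · have e2 : gft (b, b) v = v.2 - v.1 := if_pos ⟨h.1.trans hb, le_rfl, h2⟩
      linarith [gft_nonneg (a, a) v]
    -- Here `a < s` and `b_t < b`: both valuations lie in one grid cell, which bounds the gain by
    -- the width of the cell.
    have h3 : (a : ℝ) < v.1 := not_le.1 h1
    have h4 : (v.2 : ℝ) < b := not_le.1 h2
    linarith [gft_nonneg (a, a) v, gft_nonneg (b, b) v]
  · have e : gft x v = 0 := if_neg h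
    linarith [gft_nonneg (a, a) v, gft_nonneg (b, b) v]

theorem exists_uniformGrid_neighbours {n : ℕ} (hn : 0 < n) (x : I) :
    ∃ i j, uniformGrid n i ≤ x ∧ x ≤ uniformGrid n j ∧
      (uniformGrid n j - uniformGrid n i : ℝ) ≤ 1 / n := by
  have hn' : (0 : ℝ) < n := Nat.cast_pos.2 hn
  have hx : (x : ℝ) * n ≤ n := mul_le_of_le_one_left hn'.le x.2.2
  have hx0 : (0 : ℝ) ≤ x * n := mul_nonneg x.2.1 hn'.le
  refine ⟨⟨⌊(x : ℝ) * n⌋₊, Nat.lt_succ_of_le (Nat.floor_le_of_le hx)⟩,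
    ⟨⌈(x : ℝ) * n⌉₊, Nat.lt_succ_of_le (Nat.ceil_le.2 hx)⟩, ?_, ?_, ?_⟩
  · exact Subtype.coe_le_coe.1 ((div_le_iff₀ hn').2 (Nat.floor_le hx0))
  · exact Subtype.coe_le_coe.1 ((le_div_iff₀ hn').2 (Nat.le_ceil _))
  · have h : (⌈(x : ℝ) * n⌉₊ : ℝ) ≤ ⌊(x : ℝ) * n⌋₊ + 1 := by
      exact_mod_cast Nat.ceil_le_floor_add_one _
    change (⌈(x : ℝ) * n⌉₊ : ℝ) / n - (⌊(x : ℝ) * n⌋₊ : ℝ) / n ≤ 1 / n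
    rw [← sub_div]
    gcongr
    linarith

/-- Discretization: two prices earn at most twice the best single price of the uniform grid,
plus `1 / n` per round. -/
theorem sum_gft_le_of_grid {T n : ℕ} (hn : 0 < n) (v : Fin T → I × I) {M : ℝ}
    (hM : ∀ i, ∑ t, gft (uniformGrid n i, uniformGrid n i) (v t) ≤ M) (x : I × I) :
    ∑ t, gft x (v t) ≤ 2 * M + T / n := by
  obtain ⟨i, j, hi, hj, hij⟩ := exists_uniformGrid_neighbours hn x.1
  calc ∑ t, gft x (v t)
      ≤ ∑ t, (gft (uniformGrid n i, uniformGrid n i) (v t)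
          + gft (uniformGrid n j, uniformGrid n j) (v t) + 1 / n) :=
        Finset.sum_le_sum fun t _ => (gft_le_add x (v t) hi hj).trans (by gcongr)
    _ ≤ 2 * M + T / n := by
        rw [Finset.sum_add_distrib, Finset.sum_add_distrib, Finset.sum_const, Finset.card_univ,
          Fintype.card_fin, nsmul_eq_mul, mul_one_div]
        linarith [hM i, hM j]

/-! ### Unbiased estimation from one bit -/

/-- The contribution of heads to the trade probability. The factor `p`, the probability of heads,
cancels the density `1 / p` of the seller's price; `p = 0` forces `s = 0`. -/
theorem mul_volume_le_mul {p s : I} (h : s ≤ p) :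
    (p : ℝ) * (volume : Measure I).real {x : I | s ≤ p * x} = p - s := by
  have h' : (s : ℝ) ≤ p := h
  rcases eq_or_lt_of_le p.2.1 with hp | hp
  · have : (s : ℝ) = 0 := le_antisymm (h'.trans hp.ge) s.2.1
    simp [← hp, this]
  · have : {x : I | s ≤ p * x} =
        Set.Ici ⟨s / p, div_nonneg s.2.1 p.2.1, div_le_one_of_le₀ h' p.2.1⟩ := by
      ext x
      change (s : ℝ) ≤ p * x ↔ (s / p : ℝ) ≤ x
      exact (div_le_iff₀' hp).symm
    rw [this, measureReal_def, unitInterval.volume_Ici, ENNReal.toReal_ofReal]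
    · field_simp
    · exact sub_nonneg.2 (div_le_one_of_le₀ h' p.2.1)

/-- The mirror image for tails, with degenerate case `p = 1`. -/
theorem mul_volume_add_mul_le {p b : I} (h : p ≤ b) :
    (1 - p : ℝ) * (volume : Measure I).real {x : I | (p + (1 - p) * x : ℝ) ≤ b} = b - p := by
  have h' : (p : ℝ) ≤ b := h
  rcases eq_or_lt_of_le p.2.2 with hp | hp
  · have : (b : ℝ) = 1 := le_antisymm b.2.2 (hp.symm.le.trans h')
    simp [hp, this]
  · have hp' : (0 : ℝ) < 1 - p := sub_pos.2 hp
    have h0 : (0 : ℝ) ≤ (b - p) / (1 - p) := div_nonneg (sub_nonneg.2 h') hp'.le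
    have : {x : I | (p + (1 - p) * x : ℝ) ≤ b} =
        Set.Iic ⟨(b - p) / (1 - p), h0, (div_le_one hp').2 (by linarith [b.2.2])⟩ := by
      ext x
      change (p + (1 - p) * x : ℝ) ≤ b ↔ (x : ℝ) ≤ (b - p) / (1 - p)
      rw [le_div_iff₀' hp']
      constructor <;> intro h <;> linarith
    rw [this, measureReal_def, unitInterval.volume_Iic, ENNReal.toReal_ofReal h0]
    field_simp

/-- The estimation procedure for the gain from trade of a single price is unbiased. -/
theorem integral_tradeBit_estimatorPrices (p : I) (v : I × I) :
    ∫ z, (if tradeBit (estimatorPrices p z) v then (1 : ℝ) else 0) = gft (p, p) v := by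
  classical
  by_cases h : v.1 ≤ p ∧ p ≤ v.2
  · have hA : MeasurableSet {x : I | v.1 ≤ p * x} := measurableSet_le measurable_const (by fun_prop)
    have hB : MeasurableSet {x : I | (p + (1 - p) * x : ℝ) ≤ v.2} :=
      measurableSet_le (by fun_prop) measurable_const
    have e : ∀ z : I × I, (if tradeBit (estimatorPrices p z) v then (1 : ℝ) else 0) =
        (Set.Iio p ×ˢ {x : I | v.1 ≤ p * x}).indicator 1 z +
        (Set.Ici p ×ˢ {x : I | (p + (1 - p) * x : ℝ) ≤ v.2}).indicator 1 z := by
      intro z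
      have hz1 := (estimatorPrices_le p z)
      by_cases hz : z.1 < p
      · have hE : estimatorPrices p z = (p * z.2, p) := if_pos hz
        rw [hE] at hz1 ⊢
        simp only [tradeBit, Set.indicator, Set.mem_prod, Set.mem_Iio, Set.mem_Ici, hz,
          not_le.2 hz, Set.mem_ofPred_eq, true_and, false_and, if_false, add_zero, h.2, and_true,
          hz1, decide_eq_true_eq, Pi.one_apply]
      · have hE : estimatorPrices p z = (p, ⟨p + (1 - p) * z.2, _⟩) := if_neg hz
        rw [hE] at hz1 ⊢
        simp only [tradeBit, Set.indicator, Set.mem_prod, Set.mem_Iio, Set.mem_Ici, hz,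
          not_lt.1 hz, Set.mem_ofPred_eq, true_and, false_and, if_false, zero_add, h.1,
          hz1, decide_eq_true_eq, Pi.one_apply]
        rfl
    have hA' := measurableSet_Iio (a := p) |>.prod hA
    have hB' := measurableSet_Ici (a := p) |>.prod hB
    simp_rw [e]
    rw [integral_add ((integrable_const 1).indicator hA') ((integrable_const 1).indicator hB'),
      integral_indicator_one hA', integral_indicator_one hB', Measure.volume_eq_prod,
      measureReal_prod_prod, measureReal_prod_prod]
    have e1 : (volume : Measure I).real (Set.Iio p) = p := by
      rw [measureReal_def, unitInterval.volume_Iio, ENNReal.toReal_ofReal p.2.1]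
    have e2 : (volume : Measure I).real (Set.Ici p) = 1 - p := by
      rw [measureReal_def, unitInterval.volume_Ici, ENNReal.toReal_ofReal (sub_nonneg.2 p.2.2)]
    rw [e1, e2, mul_volume_le_mul h.1, mul_volume_add_mul_le h.2]
    have : gft (p, p) v = v.2 - v.1 := if_pos ⟨h.1, le_rfl, h.2⟩
    rw [this]
    ring
  · have e0 : gft (p, p) v = 0 := if_neg fun h' => h ⟨h'.1, h'.2.2⟩
    have e : ∀ z, tradeBit (estimatorPrices p z) v = false := by
      intro z
      refine decide_eq_false fun h' => h ?_
      obtain ⟨h1, -, h3⟩ := h'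
      by_cases hz : z.1 < p
      · have hE : estimatorPrices p z = (p * z.2, p) := if_pos hz
        rw [hE] at h1 h3
        exact ⟨h1.trans unitInterval.mul_le_left, h3⟩
      · have hE : estimatorPrices p z = (p, ⟨p + (1 - p) * z.2, _⟩) := if_neg hz
        have hz1 := estimatorPrices_le p z
        rw [hE] at h1 h3 hz1
        exact ⟨h1, hz1.trans h3⟩
    simp [e, e0]

/-- Under the uniform law on injections, the image of each point is uniform. -/
theorem integral_injectionLaw {K D : ℕ} (hK : K ≤ D) (i : Fin K) (f : Fin D → ℝ) :
    ∫ h, f (h i) ∂injectionLaw hK = (∑ r, f r) / D := by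
  have : Nonempty (Fin K ↪ Fin D) := ⟨Fin.castLEEmb hK⟩
  have : NeZero D := ⟨(i.pos.trans_le hK).ne'⟩
  have hD : (D : ℝ) ≠ 0 := Nat.cast_ne_zero.2 (NeZero.ne D)
  -- A cyclic shift of the block permutes the injections. Averaging over all shifts makes the
  -- position of `i` uniform without counting injections.
  have hshift : ∀ c : Fin D, ∑ h : Fin K ↪ Fin D, f (h i + c) = ∑ h : Fin K ↪ Fin D, f (h i) :=
    fun c => Fintype.sum_equiv ((Equiv.refl (Fin K)).embeddingCongr (Equiv.addRight c))
      _ _ fun _ => rfl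
  have hsum : (D : ℝ) * ∑ h : Fin K ↪ Fin D, f (h i)
      = Fintype.card (Fin K ↪ Fin D) * ∑ r, f r := by
    calc (D : ℝ) * ∑ h : Fin K ↪ Fin D, f (h i)
        = ∑ c : Fin D, ∑ h : Fin K ↪ Fin D, f (h i + c) := by simp [hshift]
      _ = ∑ h : Fin K ↪ Fin D, ∑ c : Fin D, f (h i + c) := Finset.sum_comm
      _ = ∑ h : Fin K ↪ Fin D, ∑ r, f r :=
        Finset.sum_congr rfl fun h _ => Fintype.sum_equiv (Equiv.addLeft (h i)) _ _ fun _ => rfl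
      _ = _ := by simp
  have hc : (Fintype.card (Fin K ↪ Fin D) : ℝ) ≠ 0 := Nat.cast_ne_zero.2 Fintype.card_ne_zero
  unfold injectionLaw
  rw [PMF.integral_eq_sum]
  simp only [PMF.uniformOfFintype_apply, ENNReal.toReal_inv, ENNReal.toReal_natCast, smul_eq_mul]
  rw [← Finset.mul_sum]
  field_simp
  linarith

/-! ### Multiplicative Weights -/

/-- Sampling by inversion yields the index `k` with probability at least `w k / ∑ j, w j`. -/
theorem div_sum_le_volume_sample {K : ℕ} [NeZero K] {w : Fin K → ℝ} (hw : ∀ k, 0 < w k)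
    (k : Fin K) : w k / ∑ j, w j ≤ (volume : Measure I).real {u | sample w u = k} := by
  classical
  set W := ∑ j, w j
  have hW : 0 < W := Finset.sum_pos (fun j _ => hw j) ⟨k, Finset.mem_univ k⟩
  set A := ∑ j ∈ Finset.Iio k, w j with hA
  have hC : ∑ j ∈ Finset.Iic k, w j = A + w k := by
    rw [hA, ← Finset.Iio_insert, Finset.sum_insert (by simp), add_comm]
  have hA0 : 0 ≤ A := Finset.sum_nonneg fun j _ => (hw j).le
  have hAW : A + w k ≤ W := hC ▸ Finset.sum_le_sum_of_subset_of_nonneg (Finset.subset_univ _)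
    fun j _ _ => (hw j).le
  have h1 : A / W ≤ (A + w k) / W := by gcongr; linarith [hw k]
  have h2 : (A + w k) / W ≤ 1 := (div_le_one hW).2 hAW
  -- The half-open interval excludes `u = 1`, where `Fin.ofNat` would wrap around. An inclusion is
  -- enough, since only a lower bound on the expectation of nonnegative gains is needed.
  have hsub : Set.Ico (⟨A / W, div_nonneg hA0 hW.le, h1.trans h2⟩ : I)
      ⟨(A + w k) / W, (div_nonneg hA0 hW.le).trans h1, h2⟩ ⊆ {u | sample w u = k} := by
    rintro u ⟨hu1, hu2⟩
    have hu1' : A ≤ u * W := (div_le_iff₀ hW).1 hu1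
    have hu2' : u * W < A + w k := (lt_div_iff₀ hW).1 hu2
    have hmono : ∀ i j : Fin K, i ≤ j → ∑ l ∈ Finset.Iic i, w l ≤ ∑ l ∈ Finset.Iic j, w l :=
      fun i j hij => Finset.sum_le_sum_of_subset_of_nonneg (Finset.Iic_subset_Iic.2 hij)
        fun l _ _ => (hw l).le
    have hiff : ∀ i : Fin K, ∑ j ∈ Finset.Iic i, w j ≤ u * W ↔ i < k := by
      intro i
      constructor
      · intro h
        by_contra hki
        have := hmono k i (not_lt.1 hki)
        linarith
      · intro h
        refine le_trans (Finset.sum_le_sum_of_subset_of_nonneg ?_ fun l _ _ => (hw l).le) hu1'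
        intro l hl
        simp only [Finset.mem_Iic, Finset.mem_Iio] at hl ⊢
        exact hl.trans_lt h
    have hcount : (∑ i, if ∑ j ∈ Finset.Iic i, w j ≤ u * W then 1 else 0) = (k : ℕ) := by
      simp_rw [hiff]
      rw [Finset.sum_boole]
      have : Finset.univ.filter (fun i : Fin K => i < k) = Finset.Iio k := by ext; simp
      simp [this]
    change sample w u = k
    unfold sample
    rw [hcount]
    exact Fin.ofNat_val_eq_self k
  refine le_trans (le_of_eq ?_) (measureReal_mono hsub)
  rw [measureReal_def, unitInterval.volume_Ico, ENNReal.toReal_ofReal (by simpa using h1)]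
  change _ = (A + w k) / W - A / W
  ring

theorem integral_comp_eq_sum {Ω : Type*} [MeasurableSpace Ω] (μ : Measure Ω) [IsFiniteMeasure μ]
    {K : ℕ} {X : Ω → Fin K} (hX : Measurable X) (f : Fin K → ℝ) :
    ∫ ω, f (X ω) ∂μ = ∑ k, μ.real {ω | X ω = k} * f k := by
  rw [← integral_map hX.aemeasurable (measurable_of_finite f).aestronglyMeasurable,
    integral_fintype (Integrable.of_finite)]
  refine Finset.sum_congr rfl fun k _ => ?_
  rw [smul_eq_mul, measureReal_def, Measure.map_apply hX (measurableSet_singleton k)]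
  rfl

theorem sum_div_le_integral_sample {K : ℕ} [NeZero K] {w f : Fin K → ℝ} (hw : ∀ k, 0 < w k)
    (hf : ∀ k, 0 ≤ f k) : (∑ k, w k * f k) / ∑ j, w j ≤ ∫ u, f (sample w u) := by
  rw [integral_comp_eq_sum _ (measurable_sample w) f, Finset.sum_div]
  refine Finset.sum_le_sum fun k _ => ?_
  rw [mul_div_right_comm]
  exact mul_le_mul_of_nonneg_right (div_sum_le_volume_sample hw k) (hf k)

theorem sub_sq_half_le_log_one_add {x : ℝ} (hx : 0 ≤ x) : x - x ^ 2 / 2 ≤ Real.log (1 + x) := by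
  refine le_trans ?_ (Real.le_log_one_add_of_nonneg hx)
  rw [le_div_iff₀ (by linarith)]
  nlinarith [pow_nonneg hx 3]

/-- A regret bound for an expert algorithm against gains in `[0, 1]`. -/
def ExpertAlgorithm.RegretAtMost {S K : ℕ} (E : ExpertAlgorithm S K) (R : ℝ) : Prop :=
  ∀ g : Fin S → Fin K → ℝ, (∀ τ k, 0 ≤ g τ k ∧ g τ k ≤ 1) → ∀ k,
    ∑ τ, g τ k - R ≤ ∑ τ, ∫ u, g τ (E.play τ (fun τ' => g (τ'.castLE τ.2.le)) u) ∂E.law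

/-- The weights of Multiplicative Weights after `m` rounds. -/
noncomputable def mwWeight {S K : ℕ} (η : ℝ) (g : Fin S → Fin K → ℝ) (m : ℕ) (k : Fin K) : ℝ :=
  ∏ τ : Fin S, if (τ : ℕ) < m then 1 + η * g τ k else 1

/-- The algorithm multiplies over `Fin τ`, an index type that varies with the round. Padding with
ones to a product over `Fin S` makes the weights of consecutive rounds comparable and the potential
telescope. -/
theorem prod_castLE_eq_mwWeight {S K : ℕ} (η : ℝ) (g : Fin S → Fin K → ℝ) (τ : Fin S)
    (k : Fin K) : ∏ τ' : Fin τ, (1 + η * g (τ'.castLE τ.2.le) k) = mwWeight η g τ k := by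
  unfold mwWeight
  rw [Finset.prod_ite, Finset.prod_const_one, mul_one]
  refine Finset.prod_bij (fun τ' _ => τ'.castLE τ.2.le) ?_ ?_ ?_ ?_
  · intro a _
    exact Finset.mem_filter.2 ⟨Finset.mem_univ _, a.2⟩
  · intro a _ b _ h
    exact Fin.castLE_injective _ h
  · intro b hb
    exact ⟨⟨b, (Finset.mem_filter.1 hb).2⟩, Finset.mem_univ _, rfl⟩
  · intro a _
    rfl

theorem mwWeight_succ {S K : ℕ} (η : ℝ) (g : Fin S → Fin K → ℝ) (τ : Fin S) (k : Fin K) :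
    mwWeight η g (τ + 1) k = mwWeight η g τ k * (1 + η * g τ k) := by
  classical
  unfold mwWeight
  have : (1 + η * g τ k) = ∏ τ' : Fin S, if τ' = τ then 1 + η * g τ' k else 1 := by simp
  rw [this, ← Finset.prod_mul_distrib]
  refine Finset.prod_congr rfl fun τ' _ => ?_
  rcases lt_trichotomy τ' τ with h | h | h
  · have h' : (τ' : ℕ) < τ := h
    simp [h', h.ne, h'.trans (Nat.lt_succ_self _)]
  · simp [h]
  · have h' : (τ : ℕ) < τ' := h
    rw [if_neg (by omega), if_neg (by omega), if_neg h.ne', one_mul]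

theorem mwWeight_pos {S K : ℕ} {η : ℝ} (hη : 0 ≤ η) {g : Fin S → Fin K → ℝ}
    (hg : ∀ τ k, 0 ≤ g τ k) (m : ℕ) (k : Fin K) : 0 < mwWeight η g m k := by
  refine Finset.prod_pos fun τ _ => ?_
  split_ifs
  · linarith [mul_nonneg hη (hg τ k)]
  · exact one_pos

/-- The regret of Multiplicative Weights with learning rate `η`, multiplied by `η`. -/
theorem mw_potential_bound {S K : ℕ} [NeZero K] {η : ℝ} (hη : 0 ≤ η) {g : Fin S → Fin K → ℝ}
    (hg : ∀ τ k, 0 ≤ g τ k ∧ g τ k ≤ 1) (k : Fin K) :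
    η * ∑ τ, g τ k - S * (η ^ 2 / 2) ≤ Real.log K +
      η * ∑ τ : Fin S, (∑ j, mwWeight η g τ j * g τ j) / ∑ j, mwWeight η g τ j := by
  have hw := fun m j => mwWeight_pos hη (fun τ k => (hg τ k).1) m j
  have hW : ∀ m, 0 < ∑ j, mwWeight η g m j := fun m =>
    Finset.sum_pos (fun j _ => hw m j) ⟨k, Finset.mem_univ k⟩
  -- The potential is the logarithm of the total weight. If `P` is the mean gain under the current
  -- weights, the total grows by the factor `1 + η * P`, and `log (1 + η * P) ≤ η * P`.
  have hstep : ∀ τ : Fin S, Real.log (∑ j, mwWeight η g (τ + 1) j)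
      ≤ Real.log (∑ j, mwWeight η g τ j) +
        η * ((∑ j, mwWeight η g τ j * g τ j) / ∑ j, mwWeight η g τ j) := by
    intro τ
    set W := ∑ j, mwWeight η g τ j with hWdef
    set P := (∑ j, mwWeight η g τ j * g τ j) / W with hP
    have hP0 : 0 ≤ P := div_nonneg
      (Finset.sum_nonneg fun j _ => mul_nonneg (hw _ _).le (hg _ _).1) (hW _).le
    have e : ∑ j, mwWeight η g (τ + 1) j = W * (1 + η * P) := by
      have : W * P = ∑ j, mwWeight η g τ j * g τ j := mul_div_cancel₀ _ (hW τ).ne'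
      rw [mul_add, mul_one, mul_left_comm, this, Finset.mul_sum, hWdef, ← Finset.sum_add_distrib]
      refine Finset.sum_congr rfl fun j _ => ?_
      rw [mwWeight_succ]
      ring
    have h1 : 0 < 1 + η * P := by linarith [mul_nonneg hη hP0]
    rw [e, Real.log_mul (hW _).ne' h1.ne']
    linarith [Real.log_le_sub_one_of_pos h1]
  have htel : ∑ τ : Fin S, (Real.log (∑ j, mwWeight η g (τ + 1) j)
      - Real.log (∑ j, mwWeight η g τ j)) =
      Real.log (∑ j, mwWeight η g S j) - Real.log (∑ j, mwWeight η g 0 j) := by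
    rw [Fin.sum_univ_eq_sum_range (fun m => Real.log (∑ j, mwWeight η g (m + 1) j)
      - Real.log (∑ j, mwWeight η g m j)) S]
    exact Finset.sum_range_sub (fun m => Real.log (∑ j, mwWeight η g m j)) S
  have h0 : ∑ j, mwWeight η g 0 j = K := by simp [mwWeight]
  -- The final total is at least the weight of `k` alone; each factor of that weight loses at most
  -- `η ^ 2 / 2` against the linear term.
  have hlow : η * ∑ τ, g τ k - S * (η ^ 2 / 2) ≤ Real.log (mwWeight η g S k) := by
    have : mwWeight η g S k = ∏ τ, (1 + η * g τ k) :=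
      Finset.prod_congr rfl fun τ _ => if_pos τ.2
    rw [this, Real.log_prod fun τ _ => by linarith [mul_nonneg hη (hg τ k).1]]
    have : η * ∑ τ, g τ k - S * (η ^ 2 / 2) = ∑ τ : Fin S, (η * g τ k - η ^ 2 / 2) := by
      simp [Finset.sum_sub_distrib, Finset.mul_sum]
    rw [this]
    refine Finset.sum_le_sum fun τ _ => ?_
    refine le_trans ?_ (sub_sq_half_le_log_one_add (mul_nonneg hη (hg τ k).1))
    have h2 : (η * g τ k) ^ 2 ≤ η ^ 2 :=
      pow_le_pow_left₀ (mul_nonneg hη (hg τ k).1) (mul_le_of_le_one_right hη (hg τ k).2) 2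
    linarith
  have hup : Real.log (mwWeight η g S k) ≤ Real.log (∑ j, mwWeight η g S j) :=
    Real.log_le_log (hw _ _)
      (Finset.single_le_sum (fun j _ => (hw S j).le) (Finset.mem_univ k))
  have hsum := Finset.sum_le_sum fun (τ : Fin S) (_ : τ ∈ Finset.univ) =>
    sub_le_iff_le_add'.2 (hstep τ)
  rw [htel, h0, ← Finset.mul_sum] at hsum
  linarith

/-- Dividing the potential bound by `η` leaves `log K / η + S * η / 2`. For this `η` the two terms
are `√(S * log K)` and half of it, whence `3 / 2`. -/
theorem multiplicativeWeights_regretAtMost {S K : ℕ} [NeZero K] (hS : 0 < S) (hK : 2 ≤ K) :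
    (multiplicativeWeights S K (√(Real.log K / S))).RegretAtMost
      (3 / 2 * √(S * Real.log K)) := by
  intro g hg k
  have hS' : (0 : ℝ) < S := Nat.cast_pos.2 hS
  have hL : 0 < Real.log K := Real.log_pos (by exact_mod_cast hK)
  set η := √(Real.log K / S)
  have hη : 0 < η := Real.sqrt_pos.2 (by positivity)
  have hsq : η ^ 2 = Real.log K / S := Real.sq_sqrt (by positivity)
  have hR : √(S * Real.log K) = S * η := by
    rw [Real.sqrt_eq_iff_eq_sq (by positivity) (by positivity), mul_pow, hsq]
    field_simp
  have hplay : ∑ τ : Fin S, (∑ j, mwWeight η g τ j * g τ j) / ∑ j, mwWeight η g τ j ≤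
      ∑ τ, ∫ u, g τ ((multiplicativeWeights S K η).play τ (fun τ' => g (τ'.castLE τ.2.le)) u)
        ∂(multiplicativeWeights S K η).law := by
    refine Finset.sum_le_sum fun τ _ => ?_
    refine (sum_div_le_integral_sample (fun j => mwWeight_pos hη.le (fun τ k => (hg τ k).1) τ j)
      fun j => (hg τ j).1).trans (le_of_eq ?_)
    have hmp := measurePreserving_eval (fun _ : Fin S => (volume : Measure I)) τ
    rw [← hmp.map_eq, integral_map hmp.measurable.aemeasurable (Measurable.aestronglyMeasurable
      (f := fun u => g τ (sample (mwWeight η g τ) u))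
      ((measurable_of_finite (g τ)).comp (measurable_sample _)))]
    rw [show mwWeight η g τ = fun k => ∏ τ' : Fin τ, (1 + η * g (τ'.castLE τ.2.le) k) from
      funext fun k => (prod_castLE_eq_mwWeight η g τ k).symm]
    rfl
  have hpot := mw_potential_bound hη.le hg k
  have e : S * (η ^ 2 / 2) + Real.log K = η * (3 / 2 * (S * η)) := by
    have : Real.log K = S * η ^ 2 := by rw [hsq]; field_simp
    rw [this]
    ring
  rw [hR]
  refine le_trans ?_ hplay
  refine le_of_mul_le_mul_left ?_ hη
  rw [mul_sub]
  linarith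

/-! ### Feedback and measurability of the posted prices -/

namespace Learner

variable {T : ℕ}

theorem feedback_apply (A : Learner T) (v : Fin T → I × I) (ω : A.Seed) (t : ℕ) (ht : t ≤ T)
    (j : Fin t) :
    A.feedback v ω t ht j =
      tradeBit (A.prices v ⟨j, j.2.trans_le ht⟩ ω) (v ⟨j, j.2.trans_le ht⟩) := by
  induction t with
  | zero => exact j.elim0
  | succ t ih =>
    unfold feedback
    dsimp only
    refine Fin.lastCases ?_ (fun i => ?_) j
    · rw [Fin.snoc_last]
      rfl
    · rw [Fin.snoc_castSucc]
      exact ih _ i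

theorem measurable_post_comp (A : Learner T) (t : Fin T) {f : A.Seed → Fin t → Bool}
    (hf : Measurable f) : Measurable fun ω => A.post t (f ω) ω :=
  (measurable_from_prod_countable_right (f := fun x : (Fin t → Bool) × A.Seed => A.post t x.1 x.2)
    fun past => A.measurable_post t past).comp (hf.prodMk measurable_id)

theorem measurable_prices (A : Learner T) (v : Fin T → I × I) (t : Fin T) :
    Measurable (A.prices v t) := by
  -- The prices of a round depend on the seed and on the bits of earlier rounds, so measurability
  -- propagates by strong induction.
  obtain ⟨t, ht⟩ := t
  induction t using Nat.strong_induction_on with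
  | _ t ih =>
    refine A.measurable_post_comp ⟨t, ht⟩ (measurable_pi_iff.2 fun j => ?_)
    simp only [feedback_apply]
    exact (measurable_tradeBit _).comp (ih j j.2 _)

theorem integrable_gft_prices (A : Learner T) (v : Fin T → I × I) (t : Fin T) :
    Integrable (fun ω => gft (A.prices v t ω) (v t)) A.law :=
  Integrable.of_bound ((measurable_gft _).comp (A.measurable_prices v t)).aestronglyMeasurable 1
    (ae_of_all _ fun ω => by
      rw [Real.norm_of_nonneg (gft_nonneg _ _)]
      exact gft_le_one _ _)

end Learner

/-! ### Block structure for a fixed seed -/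

/-- A sum over `T` rounds, arranged in `S` blocks of length `D`; dummy rounds contribute `0`. -/
theorem sum_eq_sum_blocks {T S D : ℕ} (h : T ≤ S * D) (φ : Fin T → ℝ) :
    ∑ t, φ t = ∑ τ : Fin S, ∑ r : Fin D,
      if hr : τ * D + r < T then φ ⟨τ * D + r, hr⟩ else 0 := by
  let ψ : ℕ → ℝ := fun m => if hr : m < T then φ ⟨m, hr⟩ else 0
  have e1 : ∑ t, φ t = ∑ m ∈ Finset.range T, ψ m := by
    rw [← Fin.sum_univ_eq_sum_range]
    exact Finset.sum_congr rfl fun t _ => (show ψ t = φ t from dif_pos t.2).symm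
  have e2 : ∑ m ∈ Finset.range T, ψ m = ∑ m ∈ Finset.range (S * D), ψ m :=
    Finset.sum_subset (Finset.range_mono h) fun m _ hm =>
      dif_neg fun h' => hm (Finset.mem_range.2 h')
  rw [e1, e2, ← Fin.sum_univ_eq_sum_range, ← finProdFinEquiv.sum_comp, Fintype.sum_prod_type]
  refine Finset.sum_congr rfl fun τ _ => Finset.sum_congr rfl fun r _ => ?_
  have : ((finProdFinEquiv (τ, r) : Fin (S * D)) : ℕ) = τ * D + r := by
    rw [finProdFinEquiv_apply_val, mul_comm, add_comm]
  rw [this]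

section Block

variable {T S K : ℕ}

/-- The bits received in the exploration rounds of block `τ` if the injection of this block is
`x.1` and the randomness of the estimation procedures is `x.2`; dummy rounds yield no trade. -/
noncomputable def explorationBits (Q : Fin K → I) (v : Fin T → I × I) {D : ℕ} (τ : Fin S)
    (x : (Fin K ↪ Fin D) × (Fin K → I × I)) (i : Fin K) : Bool :=
  if hr : τ * D + x.1 i < T then tradeBit (estimatorPrices (Q i) (x.2 i)) (v ⟨τ * D + x.1 i, hr⟩)
  else false

/-- The gain from trade of the price `Q k` in the whole block `τ`. -/
noncomputable def blockGain (Q : Fin K → I) (v : Fin T → I × I) (D : ℕ) (τ : Fin S) (k : Fin K) :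
    ℝ :=
  ∑ r : Fin D, if hr : τ * D + r < T then gft (Q k, Q k) (v ⟨τ * D + r, hr⟩) else 0

/-- A bit as a real number. -/
def bitValue (b : Bool) : ℝ := if b then 1 else 0

theorem bitValue_mem (b : Bool) : 0 ≤ bitValue b ∧ bitValue b ≤ 1 := by
  cases b <;> simp [bitValue]

theorem sum_gft_eq_sum_blockGain {D : ℕ} (h : T ≤ S * D) (Q : Fin K → I) (v : Fin T → I × I)
    (k : Fin K) : ∑ t, gft (Q k, Q k) (v t) = ∑ τ : Fin S, blockGain Q v D τ k :=
  sum_eq_sum_blocks h _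

theorem blockPrices_apply {D : ℕ} (Q : Fin K → I) (h : Fin K ↪ Fin D) (z : Fin K → I × I)
    (a i : Fin K) : blockPrices Q h z a (h i) = estimatorPrices (Q i) (z i) := by
  have hi : ∃ j, (h j : ℕ) = h i := ⟨i, rfl⟩
  have e : hi.choose = i := h.injective (Fin.ext hi.choose_spec)
  unfold blockPrices
  rw [dif_pos hi, e]

theorem blockPrices_of_notMem {D : ℕ} (Q : Fin K → I) (h : Fin K ↪ Fin D) (z : Fin K → I × I)
    (a : Fin K) {r : ℕ} (hr : ¬ ∃ i, (h i : ℕ) = r) : blockPrices Q h z a r = (Q a, Q a) :=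
  dif_neg hr

/-- In a block, exploration costs at most `K`. -/
theorem blockGain_sub_le {D : ℕ} (Q : Fin K → I) (v : Fin T → I × I) (τ : Fin S)
    (h : Fin K ↪ Fin D) (z : Fin K → I × I) (a : Fin K) :
    blockGain Q v D τ a - K ≤ ∑ r : Fin D, if hr : τ * D + r < T then
      gft (blockPrices Q h z a r) (v ⟨τ * D + r, hr⟩) else 0 := by
  classical
  -- Charging 1 to each exploration round of the block makes the claim a comparison round by round;
  -- outside these rounds the posted price is `Q a` itself.
  have hcard : (K : ℝ) = ∑ r : Fin D, if ∃ i, (h i : ℕ) = r then 1 else 0 := by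
    have : Finset.univ.filter (fun r : Fin D => ∃ i, (h i : ℕ) = r) = Finset.univ.map h := by
      ext r
      simp [Fin.ext_iff]
    rw [Finset.sum_boole, this, Finset.card_map, Finset.card_univ, Fintype.card_fin]
  rw [hcard, blockGain, ← Finset.sum_sub_distrib]
  refine Finset.sum_le_sum fun r _ => ?_
  by_cases hi : ∃ i, (h i : ℕ) = r
  · rw [if_pos hi]
    split_ifs with hr
    · linarith [gft_le_one (Q a, Q a) (v ⟨τ * D + r, hr⟩),
        gft_nonneg (blockPrices Q h z a r) (v ⟨τ * D + r, hr⟩)]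
    · linarith
  · rw [if_neg hi, sub_zero, blockPrices_of_notMem Q h z a hi]

variable (Q : Fin K → I) (E : ExpertAlgorithm S K) (hS : 0 < S) (hK : K ≤ blockLength T S)

theorem blockDecomposition_post (t : Fin T) (past : Fin t → Bool)
    (ω : (blockDecomposition T S Q E hS hK).Seed) (τ : Fin S) {r : ℕ}
    (hr : r < blockLength T S) (ht : (t : ℕ) = τ * blockLength T S + r) :
    (blockDecomposition T S Q E hS hK).post t past ω =
      blockPrices Q (ω.1 τ) (ω.2.2 τ) (E.play τ (estimatedGains ω.1 past τ) ω.2.1) r := by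
  have h1 : (t : ℕ) / blockLength T S = τ := by
    rw [ht, mul_comm, Nat.mul_add_div (by omega), Nat.div_eq_of_lt hr, add_zero]
  have h2 : (t : ℕ) % blockLength T S = r := by
    rw [ht, mul_comm, Nat.mul_add_mod, Nat.mod_eq_of_lt hr]
  obtain rfl : (⟨t / blockLength T S, div_blockLength_lt hS t⟩ : Fin S) = τ := Fin.ext h1
  rw [← h2]
  rfl

/-- The price that the expert algorithm chooses in block `τ`, as a random variable. -/
noncomputable def blockAction (v : Fin T → I × I) (τ : Fin S)
    (ω : (blockDecomposition T S Q E hS hK).Seed) : Fin K :=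
  E.play τ (fun τ' i => bitValue (explorationBits Q v (τ'.castLE τ.2.le)
    (ω.1 (τ'.castLE τ.2.le), ω.2.2 (τ'.castLE τ.2.le)) i)) ω.2.1

/-- Exploration prices ignore the expert's choices. This cuts the recursion between feedback and
actions: what the expert is fed is a function of the injections and the estimation randomness of
earlier blocks only. -/
theorem estimatedGains_feedback (v : Fin T → I × I) (ω : (blockDecomposition T S Q E hS hK).Seed)
    {t : ℕ} (ht : t ≤ T) (τ : Fin S) (hτ : τ * blockLength T S ≤ t) :
    estimatedGains ω.1 ((blockDecomposition T S Q E hS hK).feedback v ω t ht) τ =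
      fun τ' i => bitValue (explorationBits Q v (τ'.castLE τ.2.le)
        (ω.1 (τ'.castLE τ.2.le), ω.2.2 (τ'.castLE τ.2.le)) i) := by
  funext τ' i
  set ρ : Fin S := τ'.castLE τ.2.le with hρ
  -- Every round of an earlier block precedes block `τ`, so its bit is already known and, as `t ≤
  -- T`, it is not a dummy round.
  have hlt : (τ' : ℕ) * blockLength T S + ω.1 ρ i < t := by
    refine lt_of_lt_of_le ?_ hτ
    calc (τ' : ℕ) * blockLength T S + ω.1 ρ i
        < τ' * blockLength T S + blockLength T S := by have := (ω.1 ρ i).2; omega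
      _ = (τ' + 1) * blockLength T S := by ring
      _ ≤ τ * blockLength T S := Nat.mul_le_mul_right _ τ'.2
  unfold estimatedGains
  rw [dif_pos hlt, Learner.feedback_apply]
  have hp : (blockDecomposition T S Q E hS hK).prices v ⟨_, hlt.trans_le ht⟩ ω =
      estimatorPrices (Q i) (ω.2.2 ρ i) := by
    unfold Learner.prices
    rw [blockDecomposition_post Q E hS hK _ _ ω ρ (ω.1 ρ i).2 rfl, blockPrices_apply]
  rw [hp]
  unfold explorationBits bitValue
  rw [dif_pos (show (ρ : ℕ) * blockLength T S + ω.1 ρ i < T from hlt.trans_le ht)]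
  rfl

theorem blockDecomposition_prices (v : Fin T → I × I)
    (ω : (blockDecomposition T S Q E hS hK).Seed) (τ : Fin S) {r : ℕ}
    (hr : r < blockLength T S) (ht : τ * blockLength T S + r < T) :
    (blockDecomposition T S Q E hS hK).prices v ⟨τ * blockLength T S + r, ht⟩ ω =
      blockPrices Q (ω.1 τ) (ω.2.2 τ) (blockAction Q E hS hK v τ ω) r := by
  unfold Learner.prices
  rw [blockDecomposition_post Q E hS hK _ _ ω τ hr rfl,
    estimatedGains_feedback Q E hS hK v ω _ τ (Nat.le_add_right _ _)]
  rfl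

theorem le_mul_blockLength (hS : 0 < S) : T ≤ S * blockLength T S := by
  simpa [smul_eq_mul, blockLength] using le_smul_ceilDiv (b := T) hS

theorem sum_blockGain_sub_le_sum_gft (v : Fin T → I × I)
    (ω : (blockDecomposition T S Q E hS hK).Seed) :
    ∑ τ, blockGain Q v (blockLength T S) τ (blockAction Q E hS hK v τ ω) - S * K ≤
      ∑ t, gft ((blockDecomposition T S Q E hS hK).prices v t ω) (v t) := by
  rw [sum_eq_sum_blocks (le_mul_blockLength (T := T) hS) fun t =>
    gft ((blockDecomposition T S Q E hS hK).prices v t ω) (v t)]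
  have : (S * K : ℝ) = ∑ _τ : Fin S, (K : ℝ) := by simp
  rw [this, ← Finset.sum_sub_distrib]
  refine Finset.sum_le_sum fun τ _ => ?_
  refine (blockGain_sub_le Q v τ (ω.1 τ) (ω.2.2 τ) _).trans (le_of_eq ?_)
  refine Finset.sum_congr rfl fun r _ => ?_
  split_ifs with hr
  · rw [blockDecomposition_prices Q E hS hK v ω τ r.2 hr]
  · rfl

end Block

/-! ### Independence across blocks and reduction to expert regret -/

theorem integrable_comp_of_finite {Ω α : Type*} [MeasurableSpace Ω] [Finite α]
    [MeasurableSpace α] [MeasurableSingletonClass α] (μ : Measure Ω) [IsFiniteMeasure μ]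
    {X : Ω → α} (hX : Measurable X) (f : α → ℝ) : Integrable (fun ω => f (X ω)) μ :=
  (Integrable.of_finite (f := f) (μ := μ.map X)).comp_measurable hX

theorem integral_comp_of_measurePreserving {Ω α : Type*} [MeasurableSpace Ω] [MeasurableSpace α]
    {μ : Measure Ω} {ν : Measure α} {X : Ω → α} (hX : MeasurePreserving X μ ν) {g : α → ℝ}
    (hg : AEStronglyMeasurable g ν) : ∫ ω, g (X ω) ∂μ = ∫ x, g x ∂ν := by
  rw [← hX.map_eq] at hg ⊢
  exact (integral_map hX.measurable.aemeasurable hg).symm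

/-- Under a product law, a function of the coordinates before `τ` and a function of the
coordinate `τ` are independent. -/
theorem integral_pi_mul_of_lt {S : ℕ} {β : Type*} [MeasurableSpace β] [Finite β]
    [MeasurableSingletonClass β] (ν : Fin S → Measure β) [∀ τ, IsProbabilityMeasure (ν τ)]
    (τ : Fin S) (f : (Fin τ → β) → ℝ) (g : β → ℝ) :
    ∫ b, f (fun τ' => b (τ'.castLE τ.2.le)) * g (b τ) ∂Measure.pi ν =
      (∫ b, f (fun τ' => b (τ'.castLE τ.2.le)) ∂Measure.pi ν) * ∫ x, g x ∂ν τ := by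
  have hind := (ProbabilityTheory.iIndepFun_pi (μ := ν) (X := fun _ => id)
    fun _ => aemeasurable_id).indepFun_finset (Finset.Iio τ) {τ} (by simp)
    fun i => measurable_pi_apply i
  have hind' := hind.comp (φ := fun y => f fun τ' => y ⟨τ'.castLE τ.2.le,
      Finset.mem_Iio.2 (show (τ' : ℕ) < τ from τ'.2)⟩)
    (ψ := fun y => g (y ⟨τ, Finset.mem_singleton_self τ⟩))
    (measurable_of_finite _) (measurable_of_finite _)
  have h := hind'.integral_mul_eq_mul_integral
    (measurable_of_finite _).aestronglyMeasurable (measurable_of_finite _).aestronglyMeasurable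
  have e : ∫ b, g (b τ) ∂Measure.pi ν = ∫ x, g x ∂ν τ :=
    integral_comp_of_measurePreserving (measurePreserving_eval ν τ)
      (measurable_of_finite g).aestronglyMeasurable
  rw [← e]
  exact h

/-- An expert algorithm with small regret has small regret in expectation with respect to the mean
gains, if the gains are random bits that are independent across rounds. -/
theorem ExpertAlgorithm.RegretAtMost.integral_le {S K : ℕ} {E : ExpertAlgorithm S K} {R : ℝ}
    (hE : E.RegretAtMost R) (ν : Fin S → Measure (Fin K → Bool))
    [∀ τ, IsProbabilityMeasure (ν τ)] (k : Fin K) :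
    ∑ τ, ∫ x, bitValue (x k) ∂ν τ - R ≤
      ∑ τ, ∫ b, ∫ u, (∫ x, bitValue (x (E.play τ
        (fun τ' i => bitValue (b (τ'.castLE τ.2.le) i)) u)) ∂ν τ) ∂E.law ∂Measure.pi ν := by
  -- The mean gain of the action may be replaced by its realized bit. Expanding over the action `j`
  -- separates the probability of playing `j`, a function of earlier bits, from the bit of round
  -- `τ`, which is independent of them.
  have hrw : ∀ τ, ∫ b, ∫ u, (∫ x, bitValue (x (E.play τ
        (fun τ' i => bitValue (b (τ'.castLE τ.2.le) i)) u)) ∂ν τ) ∂E.law ∂Measure.pi ν =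
      ∫ b, ∫ u, bitValue (b τ (E.play τ
        (fun τ' i => bitValue (b (τ'.castLE τ.2.le) i)) u)) ∂E.law ∂Measure.pi ν := by
    intro τ
    have h1 : ∀ b : Fin S → Fin K → Bool, ∀ m : Fin K → ℝ, ∫ u, m (E.play τ
        (fun τ' i => bitValue (b (τ'.castLE τ.2.le) i)) u) ∂E.law = ∑ j, E.law.real {u | E.play τ
          (fun τ' i => bitValue (b (τ'.castLE τ.2.le) i)) u = j} * m j :=
      fun b m => integral_comp_eq_sum _ (E.measurable_play τ _) m
    simp_rw [fun b => h1 b fun j => ∫ x, bitValue (x j) ∂ν τ,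
      fun b : Fin S → Fin K → Bool => h1 b fun j => bitValue (b τ j)]
    rw [integral_finsetSum _ fun _ _ => Integrable.of_finite,
      integral_finsetSum _ fun _ _ => Integrable.of_finite]
    refine Finset.sum_congr rfl fun j _ => ?_
    rw [integral_mul_const]
    exact (integral_pi_mul_of_lt ν τ (fun y => E.law.real {u | E.play τ
      (fun τ' i => bitValue (y τ' i)) u = j}) fun x => bitValue (x j)).symm
  have hmean : ∀ τ, ∫ x, bitValue (x k) ∂ν τ = ∫ b, bitValue (b τ k) ∂Measure.pi ν :=
    fun τ => (integral_comp_of_measurePreserving (measurePreserving_eval ν τ)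
      (measurable_of_finite fun x => bitValue (x k)).aestronglyMeasurable).symm
  have hR : R = ∫ _b, R ∂Measure.pi ν := by simp
  simp_rw [hrw, hmean]
  rw [← integral_finsetSum _ fun _ _ => Integrable.of_finite,
    ← integral_finsetSum _ fun _ _ => Integrable.of_finite]
  nth_rewrite 1 [hR]
  rw [← integral_sub Integrable.of_finite Integrable.of_finite]
  exact integral_mono Integrable.of_finite Integrable.of_finite fun b =>
    hE (fun τ j => bitValue (b τ j)) (fun τ j => bitValue_mem _) k

section Block

variable {T S K : ℕ}

theorem measurable_explorationBits (Q : Fin K → I) (v : Fin T → I × I) {D : ℕ} (τ : Fin S) :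
    Measurable (explorationBits Q v (D := D) τ) := by
  refine measurable_from_prod_countable_right fun h => measurable_pi_iff.2 fun i => ?_
  unfold explorationBits
  dsimp only
  split_ifs with hr
  · exact (measurable_tradeBit _).comp
      ((measurable_estimatorPrices _).comp (measurable_pi_apply i))
  · exact measurable_const

/-- The law of the exploration bits of block `τ`. -/
noncomputable def explorationLaw (Q : Fin K → I) (v : Fin T → I × I) {D : ℕ} (hK : K ≤ D)
    (τ : Fin S) : Measure (Fin K → Bool) :=
  ((injectionLaw hK).prod (Measure.pi fun _ => volume)).map (explorationBits Q v τ)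

instance instProbExplorationLaw (Q : Fin K → I) (v : Fin T → I × I) {D : ℕ} (hK : K ≤ D)
    (τ : Fin S) : IsProbabilityMeasure (explorationLaw Q v hK τ) :=
  Measure.isProbabilityMeasure_map (measurable_explorationBits Q v τ).aemeasurable

/-- The expected estimate is the average gain in the block. -/
theorem mul_integral_explorationLaw (Q : Fin K → I) (v : Fin T → I × I) {D : ℕ} (hK : K ≤ D)
    (τ : Fin S) (k : Fin K) :
    D * ∫ x, bitValue (x k) ∂explorationLaw Q v hK τ = blockGain Q v D τ k := by
  have hD : (D : ℝ) ≠ 0 := Nat.cast_ne_zero.2 (k.pos.trans_le hK).ne'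
  have hm := measurable_explorationBits Q v (D := D) τ
  unfold explorationLaw
  rw [integral_map hm.aemeasurable (measurable_of_finite _).aestronglyMeasurable,
    integral_prod _ (integrable_comp_of_finite _ hm fun x => bitValue (x k))]
  let F : Fin D → ℝ := fun r =>
    if hr : τ * D + r < T then gft (Q k, Q k) (v ⟨τ * D + r, hr⟩) else 0
  -- With the injection fixed, the estimate is unbiased for the round `h k`, and both sides vanish
  -- in a dummy round. Averaging over the injection then yields the block average.
  have hz : ∀ h : Fin K ↪ Fin D, ∫ z : Fin K → I × I, bitValue (explorationBits Q v τ (h, z) k)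
      ∂Measure.pi (fun _ => volume) = F (h k) := by
    intro h
    dsimp only [F]
    split_ifs with hr
    · rw [← integral_tradeBit_estimatorPrices]
      have hmp := measurePreserving_eval (fun _ : Fin K => (volume : Measure (I × I))) k
      refine Eq.trans ?_ (integral_comp_of_measurePreserving hmp
        (g := fun z => bitValue (tradeBit (estimatorPrices (Q k) z) (v ⟨τ * D + h k, hr⟩)))
        ((measurable_of_finite bitValue).comp ((measurable_tradeBit _).comp
          (measurable_estimatorPrices _))).aestronglyMeasurable)
      unfold explorationBits bitValue
      simp only [hr, dif_pos]
    · simp [explorationBits, bitValue, hr]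
  rw [integral_congr_ae (ae_of_all _ hz), integral_injectionLaw hK k F, mul_div_cancel₀ _ hD]
  rfl

variable (Q : Fin K → I) (E : ExpertAlgorithm S K) (hS : 0 < S) (hK : K ≤ blockLength T S)

/-- The exploration bits of the blocks and the seed of the expert algorithm are independent. -/
theorem measurePreserving_explorationBits (v : Fin T → I × I) :
    MeasurePreserving (fun ω : (blockDecomposition T S Q E hS hK).Seed =>
      ((fun τ => explorationBits Q v τ (ω.1 τ, ω.2.2 τ) : Fin S → Fin K → Bool), ω.2.1))
      (blockDecomposition T S Q E hS hK).law
      ((Measure.pi fun τ => explorationLaw Q v hK τ).prod E.law) := by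
  -- Writing `h`, `u`, `z` for the injections, the expert's seed and the estimation randomness, the
  -- seed is rearranged as `(h, (u, z))`, `(h, (z, u))`, `((h, z), u)`; then `(h, z)` is regrouped
  -- block by block and mapped to bits in each block.
  have h1 := (MeasurePreserving.id (Measure.pi fun _ : Fin S => injectionLaw hK)).prod
    (Measure.measurePreserving_swap (μ := E.law)
      (ν := Measure.pi fun _ : Fin S => Measure.pi fun _ : Fin K => (volume : Measure (I × I))))
  have h2 := (measurePreserving_prodAssoc (Measure.pi fun _ : Fin S => injectionLaw hK)
    (Measure.pi fun _ : Fin S => Measure.pi fun _ : Fin K => (volume : Measure (I × I)))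
    E.law).symm
  have h3 := (measurePreserving_arrowProdEquivProdArrow (Fin K ↪ Fin (blockLength T S))
    (Fin K → I × I) (Fin S) (fun _ => injectionLaw hK)
    (fun _ => Measure.pi fun _ : Fin K => (volume : Measure (I × I)))).symm
  have h4 := measurePreserving_pi
    (fun _ : Fin S =>
      (injectionLaw hK).prod (Measure.pi fun _ : Fin K => (volume : Measure (I × I))))
    (fun τ => explorationLaw Q v hK τ) (f := fun τ => explorationBits Q v τ)
    fun τ => ⟨measurable_explorationBits Q v τ, rfl⟩
  exact (((h4.comp h3).prod (MeasurePreserving.id E.law)).comp h2).comp h1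

/-- Reduction to expert regret: the expected gain of Block-Decomposition is close to the
gain of each grid price. -/
theorem sum_gft_sub_le_sum_integral {R : ℝ} (hE : E.RegretAtMost R) (v : Fin T → I × I)
    (k : Fin K) :
    ∑ t, gft (Q k, Q k) (v t) - blockLength T S * R - S * K ≤
      ∑ t, ∫ ω, gft ((blockDecomposition T S Q E hS hK).prices v t ω) (v t)
        ∂(blockDecomposition T S Q E hS hK).law := by
  set A := blockDecomposition T S Q E hS hK
  set D := blockLength T S
  let ν : Fin S → Measure (Fin K → Bool) := fun τ => explorationLaw Q v hK τ
  have hmp := measurePreserving_explorationBits Q E hS hK v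
  let a : Fin S → (Fin S → Fin K → Bool) × E.Seed → Fin K := fun τ x =>
    E.play τ (fun τ' i => bitValue (x.1 (τ'.castLE τ.2.le) i)) x.2
  have ha : ∀ τ, Measurable (a τ) := fun τ =>
    measurable_from_prod_countable_right fun b =>
      E.measurable_play τ fun τ' i => bitValue (b (τ'.castLE τ.2.le) i)
  have hact : ∀ τ, Measurable (blockAction Q E hS hK v τ) := fun τ => (ha τ).comp hmp.measurable
  -- The action factors through the exploration bits and the expert's seed, so the expectation can
  -- be computed under their product law; a block gain is `D` times a mean bit.
  have hint : ∀ τ, ∫ ω, blockGain Q v D τ (blockAction Q E hS hK v τ ω) ∂A.law =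
      D * ∫ b, ∫ u, (∫ x, bitValue (x (a τ (b, u))) ∂ν τ) ∂E.law ∂Measure.pi ν := by
    intro τ
    have hi := integrable_comp_of_finite ((Measure.pi ν).prod E.law) (ha τ)
      (fun j => ∫ x, bitValue (x j) ∂ν τ)
    rw [← integral_prod (fun y => ∫ x, bitValue (x (a τ y)) ∂ν τ) hi, ← integral_const_mul,
      ← integral_comp_of_measurePreserving hmp (hi.const_mul _).aestronglyMeasurable]
    exact integral_congr_ae (ae_of_all _ fun ω => (mul_integral_explorationLaw Q v hK τ _).symm)
  have hreg := hE.integral_le ν k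
  have hmono : ∫ ω, (∑ τ, blockGain Q v D τ (blockAction Q E hS hK v τ ω) - S * K) ∂A.law ≤
      ∫ ω, ∑ t, gft (A.prices v t ω) (v t) ∂A.law :=
    integral_mono
      ((integrable_finsetSum _ fun τ _ => integrable_comp_of_finite _ (hact τ) _).sub
        (integrable_const _))
      (integrable_finsetSum _ fun t _ => A.integrable_gft_prices v t)
      fun ω => sum_blockGain_sub_le_sum_gft Q E hS hK v ω
  rw [integral_finsetSum _ fun t _ => A.integrable_gft_prices v t,
    integral_sub (integrable_finsetSum _ fun τ _ => integrable_comp_of_finite _ (hact τ) _)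
      (integrable_const _), integral_const, probReal_univ, one_smul,
    integral_finsetSum _ fun τ _ => integrable_comp_of_finite _ (hact τ) _] at hmono
  rw [Finset.sum_congr rfl fun τ _ => hint τ, ← Finset.mul_sum] at hmono
  have hsum : ∑ t, gft (Q k, Q k) (v t) = D * ∑ τ, ∫ x, bitValue (x k) ∂ν τ := by
    rw [sum_gft_eq_sum_blockGain (le_mul_blockLength (T := T) hS), Finset.mul_sum]
    exact Finset.sum_congr rfl fun τ _ => (mul_integral_explorationLaw Q v hK τ k).symm
  have := mul_le_mul_of_nonneg_left hreg (Nat.cast_nonneg (α := ℝ) D)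
  rw [mul_sub, ← hsum] at this
  linarith

end Block

/-! ### Regret bound and choice of parameters -/

theorem Learner.sum_integral_gft_nonneg {T : ℕ} (A : Learner T) (v : Fin T → I × I) :
    0 ≤ ∑ t, ∫ ω, gft (A.prices v t ω) (v t) ∂A.law :=
  Finset.sum_nonneg fun _ _ => integral_nonneg fun _ => gft_nonneg _ _

theorem Learner.regret_two_le_horizon {T : ℕ} (A : Learner T) (v : Fin T → I × I) :
    A.regret 2 v ≤ T := by
  have h : ⨆ x : I × I, ∑ t, gft x (v t) ≤ T := ciSup_le fun x =>
    (Finset.sum_le_sum fun t _ => gft_le_one x (v t)).trans (by simp)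
  have := A.sum_integral_gft_nonneg v
  unfold regret
  linarith

/-- The factor 2 lost in the discretization is the one allowed by the 2-regret, so twice the
learner's expected gain cancels and only error terms remain. -/
theorem blockDecomposition_uniformGrid_regret_le {T S n : ℕ} (hn : 0 < n)
    (E : ExpertAlgorithm S (n + 1)) (hS : 0 < S) (hK : n + 1 ≤ blockLength T S) {R : ℝ}
    (hE : E.RegretAtMost R) (v : Fin T → I × I) :
    (blockDecomposition T S (uniformGrid n) E hS hK).regret 2 v ≤
      T / n + 2 * (blockLength T S * R) + 2 * (S * (n + 1)) := by
  set A := blockDecomposition T S (uniformGrid n) E hS hK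
  have h : ⨆ x : I × I, ∑ t, gft x (v t) ≤
      2 * (∑ t, ∫ ω, gft (A.prices v t ω) (v t) ∂A.law + blockLength T S * R + S * (n + 1)) +
        T / n := by
    refine ciSup_le fun x => sum_gft_le_of_grid hn v (fun i => ?_) x
    have := sum_gft_sub_le_sum_integral (uniformGrid n) E hS hK hE v i
    push_cast at this
    linarith
  unfold Learner.regret
  linarith

theorem blockLength_mul_le (T S : ℕ) : blockLength T S * S ≤ T + S := by
  unfold blockLength
  rw [Nat.ceilDiv_eq_add_pred_div]
  exact (Nat.div_mul_le_self _ _).trans (Nat.sub_le _ _)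

/-- In units of `x ^ 3` the three terms are at most `5 / 4`, `3 * (111 / 100) * (71 / 100) * √L` and
`5 / 2`. As `√L ≥ 2`, the outer two cost at most `15 / 8 * √L`, and the total stays below `5 * √L`.
-/
theorem tuning_bound {x S n D T L : ℝ} (hx : 4 ≤ x) (hT : T = x ^ 4) (hL : 4 ≤ L)
    (hS0 : 0 < S) (hSx : S ≤ x ^ 2) (hxS : x ^ 2 ≤ S + 1) (hnx : n ≤ x)
    (hxn : x ≤ n + 1) (hn : 4 ≤ n) (hD : D * S ≤ T + S) {l : ℝ} (hl : l ≤ L / 2) :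
    T / n + 2 * (D * (3 / 2 * √(S * l))) + 2 * (S * (n + 1)) ≤ 5 * x ^ 3 * √L := by
  have hx0 : 0 < x := by linarith
  have hx2 : 16 ≤ x ^ 2 := by nlinarith
  have hx3 : 0 < x ^ 3 := by positivity
  have h1 : T / n ≤ 5 / 4 * x ^ 3 := by
    rw [div_le_iff₀ (by linarith), hT]
    nlinarith
  have h2 : 2 * (S * (n + 1)) ≤ 5 / 2 * x ^ 3 := by
    have : S * (n + 1) ≤ x ^ 2 * (5 / 4 * x) :=
      mul_le_mul hSx (by linarith) (by linarith) (by positivity)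
    nlinarith
  set y := √S with hy
  have hy0 : 0 < y := Real.sqrt_pos.2 hS0
  have hyS : y ^ 2 = S := Real.sq_sqrt hS0.le
  have hyx : y ≤ x := by
    rw [hy, Real.sqrt_le_left hx0.le]
    exact hSx
  -- From `S ≥ x ^ 2 - 1 ≥ 15 / 16 * x ^ 2` and `(24 / 25) ^ 2 < 15 / 16`.
  have hxy : 24 / 25 * x ≤ y := Real.le_sqrt_of_sq_le (by nlinarith)
  have hDy : D * y ≤ 111 / 100 * x ^ 3 := by
    refine le_of_mul_le_mul_right ?_ hy0
    calc D * y * y = D * S := by rw [← hyS]; ring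
      _ ≤ x ^ 4 + y ^ 2 := by rw [hyS, ← hT]; exact hD
      _ ≤ x ^ 4 + x ^ 2 := by gcongr
      _ ≤ x ^ 4 + x ^ 4 / 16 := by nlinarith
      _ ≤ 111 / 100 * x ^ 3 * (24 / 25 * x) := by nlinarith [pow_pos hx0 4]
      _ ≤ 111 / 100 * x ^ 3 * y := by gcongr
  have hLs : 2 ≤ √L := Real.le_sqrt_of_sq_le (by linarith)
  have hls : √l ≤ 71 / 100 * √L := by
    rw [Real.sqrt_le_left (by positivity), mul_pow, Real.sq_sqrt (by linarith)]
    linarith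
  have h3 : D * √(S * l) ≤ 111 / 100 * x ^ 3 * (71 / 100 * √L) := by
    rw [Real.sqrt_mul hS0.le, ← mul_assoc]
    exact mul_le_mul hDy hls (Real.sqrt_nonneg _) (by positivity)
  nlinarith

theorem four_le_log_of_le {T : ℝ} (hT : 256 ≤ T) : 4 ≤ Real.log T := by
  have h : Real.log 256 ≤ Real.log T := Real.log_le_log (by norm_num) hT
  have h2 : Real.log 256 = 8 * Real.log 2 := by
    rw [show (256 : ℝ) = 2 ^ 8 by norm_num, Real.log_pow]
    norm_num
  linarith [Real.log_two_gt_d9]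

theorem tunedBlockDecomposition_regret_le (T : ℕ) (hT : 2 ≤ T) (v : Fin T → I × I) :
    (tunedBlockDecomposition T hT).regret 2 v ≤ 5 * (T : ℝ) ^ (3 / 4 : ℝ) * √(Real.log T) := by
  have hT' : (2 : ℝ) ≤ T := by exact_mod_cast hT
  have hT0 : (0 : ℝ) ≤ T := by linarith
  set x := (T : ℝ) ^ (1 / 4 : ℝ) with hx
  have hx0 : 0 < x := Real.rpow_pos_of_pos (by linarith) _
  have hx4 : (T : ℝ) = x ^ 4 := by
    rw [hx, ← Real.rpow_natCast, ← Real.rpow_mul hT0]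
    norm_num
  have hx3 : (T : ℝ) ^ (3 / 4 : ℝ) = x ^ 3 := by
    rw [hx, ← Real.rpow_natCast, ← Real.rpow_mul hT0]
    norm_num
  rw [hx3]
  -- Below `256 = 4 ^ 4` the trivial bound `T = x ^ 3 * x ≤ 4 * x ^ 3` suffices, since `√(log 2) ≥ 4
  -- / 5`. From there on `x ≥ 4`, and rounding costs little.
  rcases lt_or_ge T 256 with hlt | hge
  · refine (Learner.regret_two_le_horizon _ v).trans ?_
    have hlt' : (T : ℝ) < 256 := by exact_mod_cast hlt
    have hx_lt : x < 4 := lt_of_pow_lt_pow_left₀ 4 (by norm_num)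
      (hx4 ▸ hlt'.trans_eq (by norm_num))
    have hlog : (4 / 5 : ℝ) ≤ √(Real.log T) := by
      refine Real.le_sqrt_of_sq_le ?_
      have := Real.log_le_log (by norm_num) hT'
      linarith [Real.log_two_gt_d9]
    calc (T : ℝ) = x ^ 3 * x := by rw [hx4]; ring
      _ ≤ x ^ 3 * (5 * √(Real.log T)) := by gcongr; linarith
      _ = _ := by ring
  · have hge' : (256 : ℝ) ≤ T := by exact_mod_cast hge
    have hx_ge : 4 ≤ x := le_of_pow_le_pow_left₀ (n := 4) (by norm_num) hx0.le
      (hx4 ▸ (by norm_num : (4 : ℝ) ^ 4 = 256).trans_le hge')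
    have hS : 0 < T.sqrt := Nat.sqrt_pos.2 (by omega)
    have hn : 0 < T.sqrt.sqrt := Nat.sqrt_pos.2 hS
    have hE := multiplicativeWeights_regretAtMost (S := T.sqrt) (K := T.sqrt.sqrt + 1) hS (by omega)
    refine (blockDecomposition_uniformGrid_regret_le hn _ hS (grid_card_le_blockLength hT) hE
      v).trans ?_
    have hSx : (T.sqrt : ℝ) ≤ x ^ 2 := by
      have : ((T.sqrt ^ 2 : ℕ) : ℝ) ≤ T := by exact_mod_cast Nat.sqrt_le' T
      push_cast at this
      exact le_of_pow_le_pow_left₀ (n := 2) (by norm_num) (by positivity)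
        (by rw [← pow_mul, ← hx4]; exact this)
    have hxS : x ^ 2 ≤ (T.sqrt : ℝ) + 1 := by
      have : (T : ℝ) ≤ ((T.sqrt.succ ^ 2 : ℕ) : ℝ) := by exact_mod_cast (Nat.lt_succ_sqrt' T).le
      push_cast at this
      exact le_of_pow_le_pow_left₀ (n := 2) (by norm_num) (by positivity)
        (by rw [← pow_mul, ← hx4]; exact this)
    have hnx : (T.sqrt.sqrt : ℝ) ≤ x := by
      have : ((T.sqrt.sqrt ^ 2 : ℕ) : ℝ) ≤ T.sqrt := by exact_mod_cast Nat.sqrt_le' T.sqrt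
      push_cast at this
      exact le_of_pow_le_pow_left₀ (n := 2) (by norm_num) hx0.le (this.trans hSx)
    have hxn : x ≤ (T.sqrt.sqrt : ℝ) + 1 := by
      have : ((T.sqrt + 1 : ℕ) : ℝ) ≤ ((T.sqrt.sqrt.succ ^ 2 : ℕ) : ℝ) := by
        exact_mod_cast Nat.succ_le_of_lt (Nat.lt_succ_sqrt' T.sqrt)
      push_cast at this
      exact le_of_pow_le_pow_left₀ (n := 2) (by norm_num) (by positivity) (hxS.trans this)
    have hn4 : (4 : ℝ) ≤ (T.sqrt.sqrt : ℝ) := by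
      have h1 : 16 ≤ T.sqrt := Nat.le_sqrt.2 (by omega)
      exact_mod_cast (Nat.le_sqrt.2 (by omega) : 4 ≤ T.sqrt.sqrt)
    have hD : (blockLength T T.sqrt : ℝ) * T.sqrt ≤ T + T.sqrt := by
      exact_mod_cast blockLength_mul_le T T.sqrt
    have hl : Real.log ((T.sqrt.sqrt + 1 : ℕ) : ℝ) ≤ Real.log T / 2 := by
      have h1 : ((T.sqrt.sqrt + 1 : ℕ) : ℝ) ≤ x ^ 2 := by
        push_cast
        nlinarith
      have h2 := Real.log_le_log (by positivity) h1
      have h3 : Real.log T = 2 * Real.log (x ^ 2) := by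
        rw [hx4, Real.log_pow, Real.log_pow]
        push_cast
        ring
      linarith
    exact tuning_bound hx_ge hx4 (four_le_log_of_le hge') (by exact_mod_cast hS) hSx hxS hnx hxn
      hn4 hD hl

end BilateralTrade

/-- Boundedness is part of the claim because a real `⨆` over an unbounded family is `0` by
convention; without it the bound on `worstRegret` could hold for no reason. -/
theorem theorem5 (T : ℕ) (hT : 2 ≤ T) :
    BddAbove (Set.range fun v : Fin T → unitInterval × unitInterval =>
      (BilateralTrade.tunedBlockDecomposition T hT).regret 2 v) ∧
    (BilateralTrade.tunedBlockDecomposition T hT).worstRegret 2 ≤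
      5 * (T : ℝ) ^ (3 / 4 : ℝ) * √(Real.log T) := by
  refine ⟨⟨5 * (T : ℝ) ^ (3 / 4 : ℝ) * √(Real.log T), ?_⟩, ciSup_le fun v =>
    BilateralTrade.tunedBlockDecomposition_regret_le T hT v⟩
  rintro _ ⟨v, rfl⟩
  exact BilateralTrade.tunedBlockDecomposition_regret_le T hT v
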